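/- All rings are commutative with $1$. Elements $a,b$ of a ring $R$ form an idempotent pair if $a(1-a)\in bR$ or $b(1-b)\in aR$; an integral domain $R$ is a PRINC domain if every ideal generated by an idempotent pair is principal. An integral domain $R$ is seminormal if whenever $a,b\in R$ satisfy $a^2=b^3$ there is $c\in R$ with $c^3=a$ and $c^2=b$. Elements $c,d\in R$ are comaximal if $(c,d)=R$. A comaximal factorization of $b$ of length $m$ is an expression $b=b_1\cdots b_m$ with $b_1,\dots,b_m$ pairwise comaximal nonunits. A nonzero nonunit is pseudo-irreducible if it is not a product of two comaximal nonunits, and $R$ is a comaximal factorization domain (CFD) if it is an integral domain and every nonzero nonunit is a product of finitely many pairwise comaximal pseudo-irreducible elements. **Theorem.** Let $D_0$ be a seminormal PRINC domain, let $D=D_0[X_n : n>0]$ be the polynomial ring in countably many indeterminates, $J=(X_i-X_{i+1}(1+X_{i+1}) : i>0)\subseteq D$, $R=D/J$, $x_n=X_n+J$ and $R_n=D_0[x_1,\dots,x_n]\subseteq R$ for $n>0$. Then $R_n=D_0[x_n]$ with $x_n$ transcendental over $D_0$ for every $n>0$, the chain $(R_n)_{n>0}$ is increasing, $R=\bigcup_{n>0}R_n$,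 and $R$ is a seminormal PRINC domain that is not a CFD. Moreover, for every integer $m\ge 1$ the element $x_1$ has a comaximal factorization of length $m$; in particular, $x_1$ has comaximal factorizations of unbounded length. -/

import Mathlib

/-- `a, b` is an idempotent pair: `a(1 - a) ∈ bR` or `b(1 - b) ∈ aR`
(equivalently, `(a b)` or `(b a)` is the first row of an idempotent `2 × 2` matrix). -/
def IsIdempotentPair {R : Type*} [CommRing R] (a b : R) : Prop :=
  b ∣ a * (1 - a) ∨ a ∣ b * (1 - b)

/-- `R` is a PRINC domain: a domain in which every ideal generated by an idempotent pair is
principal. -/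
structure IsPRINCDomain (R : Type*) [CommRing R] : Prop where
  isDomain : IsDomain R
  isPrincipal : ∀ a b : R, IsIdempotentPair a b → (Ideal.span {a, b}).IsPrincipal

/-- `R` is a seminormal domain. -/
structure IsSeminormalDomain (R : Type*) [CommRing R] : Prop where
  isDomain : IsDomain R
  exists_root : ∀ a b : R, a ^ 2 = b ^ 3 → ∃ c : R, c ^ 3 = a ∧ c ^ 2 = b

/-- A nonzero nonunit that is not a product of two comaximal nonunits.
Mathlib's `IsCoprime c d` says `∃ u v, u * c + v * d = 1`, that is, `(c, d) = R`. -/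
def IsPseudoIrreducible {R : Type*} [CommRing R] (b : R) : Prop :=
  b ≠ 0 ∧ ¬ IsUnit b ∧
    ∀ c d : R, ¬ IsUnit c → ¬ IsUnit d → IsCoprime c d → b ≠ c * d

/-- `b₀, …, bₘ₋₁` is a comaximal factorization of `b`: the `bᵢ` are pairwise comaximal nonunits
with product `b`. -/
def IsComaximalFactorization {R : Type*} [CommRing R] (b : R) {m : ℕ} (f : Fin m → R) : Prop :=
  (∀ i, ¬ IsUnit (f i)) ∧ (∀ i j, i ≠ j → IsCoprime (f i) (f j)) ∧ b = ∏ i, f i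

/-- The factors are pairwise comaximal pseudo-irreducible elements with product `b`. -/
def IsCompleteComaximalFactorization {R : Type*} [CommRing R] (b : R) {m : ℕ}
    (f : Fin m → R) : Prop :=
  (∀ i, IsPseudoIrreducible (f i)) ∧ (∀ i j, i ≠ j → IsCoprime (f i) (f j)) ∧ b = ∏ i, f i

/-- `R` is a comaximal factorization domain (CFD). -/
structure IsCFD (R : Type*) [CommRing R] : Prop where
  isDomain : IsDomain R
  exists_factorization : ∀ b : R, b ≠ 0 → ¬ IsUnit b →
    ∃ (m : ℕ) (f : Fin m → R), IsCompleteComaximalFactorization b f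

/-- The ideal `J = (Xᵢ - Xᵢ₊₁(1 + Xᵢ₊₁) : i > 0)` of `D₀[Xₙ : n > 0]`. -/
noncomputable def towerIdeal (D₀ : Type*) [CommRing D₀] : Ideal (MvPolynomial ℕ+ D₀) :=
  Ideal.span (Set.range fun i : ℕ+ =>
    MvPolynomial.X i - MvPolynomial.X (i + 1) * (1 + MvPolynomial.X (i + 1)))

/-- The ring `R = D₀[Xₙ : n > 0] / J`. -/
noncomputable abbrev TowerRing (D₀ : Type*) [CommRing D₀] : Type _ :=
  MvPolynomial ℕ+ D₀ ⧸ towerIdeal D₀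

/-- The residue class `xₙ = Xₙ + J`. -/
noncomputable def towerGen (D₀ : Type*) [CommRing D₀] (n : ℕ+) : TowerRing D₀ :=
  Ideal.Quotient.mk (towerIdeal D₀) (MvPolynomial.X n)

/-- The subring `Rₙ = D₀[x₁, …, xₙ]` of `R`. -/
noncomputable def towerSubring (D₀ : Type*) [CommRing D₀] (n : ℕ+) : Subalgebra D₀ (TowerRing D₀) :=
  Algebra.adjoin D₀ (towerGen D₀ '' Set.Iic n)

/-! Since `x_n = x_{n+1}(1 + x_{n+1})`, the ring `R` is a directed union of polynomial rings
`D₀[x_n]`, and seminormality and PRINC involve finitely many elements at a time. It therefore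
suffices that both properties pass to polynomial rings: `IsSeminormalDomain.polynomial` and
`IsPRINCDomain.polynomial`.

Both are descent statements. The problem is solved over `K[X]`, `K` the fraction field, where the
ring is integrally closed and principal. The coefficients of the solution are integral over the
base, so they generate a finite extension `B`. By `algebraMap_surjective_of_generators` a ring
seminormal in `B` equals `B` once the generators become rational in reduced algebras over fields;
there the claim follows from uniqueness of the solution, up to a constant unit in the PRINC case.
For PRINC, the problem solved is to write an idempotent `2 × 2` matrix of trace `1` as a column
times a row.

The CFD property fails because `x_n` is prime in `D₀[x_n]` but splits into comaximal nonunits one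
level up. -/

open Polynomial

universe u

/-! ### Conductors and finite extensions. -/

/-- The conductor of `B` in the image of `R`: the largest ideal of `B` inside this image. -/
def conductorIdeal (R B : Type*) [CommRing R] [CommRing B] [Algebra R B] : Ideal B where
  carrier := {x | ∀ b, x * b ∈ (algebraMap R B).range}
  add_mem' hx hy b := by rw [add_mul]; exact add_mem (hx b) (hy b)
  zero_mem' b := by simp
  smul_mem' c x hx b := by
    rw [smul_eq_mul, mul_comm c, mul_assoc]
    exact hx _

theorem mem_range_of_mem_conductorIdeal {R B : Type*} [CommRing R] [CommRing B] [Algebra R B]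
    {x : B} (hx : x ∈ conductorIdeal R B) : x ∈ (algebraMap R B).range := by
  simpa using hx 1

/-- If `x ^ 2` is in the conductor, so are the square and cube of `x * b` for each `b`, up to
factors absorbed by `B`; seminormality in `B` then puts `x * b` in the image. -/
theorem conductorIdeal_isRadical {R B : Type*} [CommRing R] [CommRing B] [Algebra R B]
    (hsn : ∀ x : B, x ^ 2 ∈ (algebraMap R B).range → x ^ 3 ∈ (algebraMap R B).range →
      x ∈ (algebraMap R B).range) :
    (conductorIdeal R B).IsRadical := by
  rw [Ideal.isRadical_iff_quotient_reduced, isReduced_iff_pow_one_lt 2 one_lt_two]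
  intro x hx
  obtain ⟨x, rfl⟩ := Ideal.Quotient.mk_surjective x
  rw [← map_pow, Ideal.Quotient.eq_zero_iff_mem] at hx
  rw [Ideal.Quotient.eq_zero_iff_mem]
  intro b
  apply hsn
  · rw [mul_pow]; exact hx _
  · rw [show (x * b) ^ 3 = x ^ 2 * (x * b ^ 3) by ring]; exact hx _

/-- Elements of `B` that are carried into the image of `R` by some element outside `P`. -/
def denominatorSubalgebra {R : Type*} (B : Type*) [CommRing R] [CommRing B] [Algebra R B]
    (P : Ideal R) [hP : P.IsPrime] : Subalgebra R B where
  carrier := {x | ∃ s ∉ P, algebraMap R B s * x ∈ (algebraMap R B).range}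
  mul_mem' := by
    rintro x y ⟨s, hs, hx⟩ ⟨t, ht, hy⟩
    refine ⟨s * t, fun h => (hP.mem_or_mem h).elim hs ht, ?_⟩
    rw [map_mul, mul_mul_mul_comm]
    exact mul_mem hx hy
  add_mem' := by
    rintro x y ⟨s, hs, hx⟩ ⟨t, ht, hy⟩
    refine ⟨s * t, fun h => (hP.mem_or_mem h).elim hs ht, ?_⟩
    have : algebraMap R B (s * t) * (x + y) = algebraMap R B t * (algebraMap R B s * x) +
        algebraMap R B s * (algebraMap R B t * y) := by rw [map_mul]; ring
    rw [this]
    exact add_mem (mul_mem ⟨t, rfl⟩ hx) (mul_mem ⟨s, rfl⟩ hy)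
  algebraMap_mem' r := ⟨1, P.one_notMem, by simp⟩

theorem exists_common_denominator {R B : Type*} [CommRing R] [CommRing B] [Algebra R B]
    [Module.Finite R B] (P : Ideal R) [hP : P.IsPrime] (h : denominatorSubalgebra B P = ⊤) :
    ∃ s ∉ P, algebraMap R B s ∈ conductorIdeal R B := by
  classical
  obtain ⟨S, hS⟩ := (Module.Finite.fg_top : (⊤ : Submodule R B).FG)
  have hx : ∀ x : B, ∃ s ∉ P, algebraMap R B s * x ∈ (algebraMap R B).range := fun x => by
    have : x ∈ denominatorSubalgebra B P := h ▸ Algebra.mem_top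
    exact this
  choose s hs hsx using hx
  refine ⟨∏ x ∈ S, s x, fun hmem => ?_, fun b => ?_⟩
  · obtain ⟨x, -, hx⟩ := hP.prod_mem_iff.mp hmem
    exact hs x hx
  · have hb : b ∈ Submodule.span R (S : Set B) := hS ▸ Submodule.mem_top
    induction hb using Submodule.span_induction with
    | mem x hx =>
      rw [← Finset.mul_prod_erase _ _ hx, map_mul, mul_right_comm]
      exact mul_mem (hsx x) ⟨_, rfl⟩
    | zero => simp
    | add x y _ _ hx hy => rw [mul_add]; exact add_mem hx hy
    | smul a x _ hx => rw [mul_smul_comm, Algebra.smul_def]; exact mul_mem ⟨a, rfl⟩ hx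

/-- After localizing at a minimal prime of `I`, the radical of `I` is the maximal ideal. -/
theorem exists_mul_pow_mem_of_mem_minimalPrimes {R : Type*} [CommRing R] {I P : Ideal R}
    (hP : P ∈ I.minimalPrimes) {x : R} (hx : x ∈ P) : ∃ s ∉ P, ∃ n, s * x ^ n ∈ I := by
  have := hP.1.1
  have h := IsLocalization.AtPrime.radical_map_of_mem_minimalPrimes
    (A := Localization.AtPrime P) P I hP
  obtain ⟨n, hn⟩ : algebraMap R (Localization.AtPrime P) x ∈ (I.map (algebraMap R _)).radical :=
    h ▸ Ideal.mem_map_of_mem _ hx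
  rw [← map_pow, IsLocalization.algebraMap_mem_map_algebraMap_iff P.primeCompl] at hn
  obtain ⟨s, hs, h⟩ := hn
  exact ⟨s, hs, n, h⟩

/-- A finite extension `B` of a ring `R` that is seminormal in `B` is trivial, provided that some
algebra generators of `B` become rational in all reduced algebras over fields. -/
theorem algebraMap_surjective_of_generators {R B : Type u} [CommRing R] [CommRing B] [Algebra R B]
    [Module.Finite R B]
    (hsn : ∀ x : B, x ^ 2 ∈ (algebraMap R B).range → x ^ 3 ∈ (algebraMap R B).range →
      x ∈ (algebraMap R B).range)
    (T : Set B) (hT : Algebra.adjoin R T = ⊤)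
    (H : ∀ (k C : Type u) [Field k] [CommRing C] [IsReduced C] (i : k →+* C)
      (ψ : R →+* k) (φ : B →+* C), φ.comp (algebraMap R B) = i.comp ψ → ∀ t ∈ T, φ t ∈ i.range) :
    Function.Surjective (algebraMap R B) := by
  by_contra hne
  set J := conductorIdeal R B
  have hI : J.comap (algebraMap R B) ≠ ⊤ := by
    intro h
    apply hne
    intro b
    have h1 : algebraMap R B 1 ∈ J := Ideal.mem_comap.mp (h ▸ Submodule.mem_top)
    simpa using h1 b
  obtain ⟨P, hP⟩ := Ideal.nonempty_minimalPrimes hI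
  have hPp : P.IsPrime := hP.1.1
  have : IsReduced (B ⧸ J) := (Ideal.isRadical_iff_quotient_reduced _).mp
    (conductorIdeal_isRadical hsn)
  let q : B →+* B ⧸ J := Ideal.Quotient.mk J
  -- `Localization M` is reduced, and `P` dies in it because elements of `P` become nilpotent there;
  -- it is thus an algebra over the residue field of `P`, and `H` applies.
  let M : Submonoid (B ⧸ J) := P.primeCompl.map (q.comp (algebraMap R B))
  let φ : B →+* Localization M := (algebraMap (B ⧸ J) (Localization M)).comp q
  have hker : ∀ x ∈ P, φ (algebraMap R B x) = 0 := by
    intro x hx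
    obtain ⟨s, hs, n, h⟩ := exists_mul_pow_mem_of_mem_minimalPrimes hP hx
    have hu : IsUnit (φ (algebraMap R B s)) :=
      IsLocalization.map_units (Localization M) (⟨_, s, hs, rfl⟩ : M)
    have h0 : φ (algebraMap R B (s * x ^ n)) = 0 := by
      have : q (algebraMap R B (s * x ^ n)) = 0 := Ideal.Quotient.eq_zero_iff_mem.mpr h
      simp only [φ, RingHom.comp_apply, this, map_zero]
    rw [map_mul, map_mul, hu.mul_right_eq_zero, map_pow, map_pow] at h0
    exact eq_zero_of_pow_eq_zero h0
  let j : R ⧸ P →+* Localization M := Ideal.Quotient.lift P (φ.comp (algebraMap R B)) hker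
  have hj : ∀ y : nonZeroDivisors (R ⧸ P), IsUnit (j y) := by
    rintro ⟨y, hy⟩
    obtain ⟨s, rfl⟩ := Ideal.Quotient.mk_surjective y
    have hs : s ∉ P := fun h => nonZeroDivisors.ne_zero hy (Ideal.Quotient.eq_zero_iff_mem.mpr h)
    exact IsLocalization.map_units (Localization M) (⟨_, s, hs, rfl⟩ : M)
  let i : FractionRing (R ⧸ P) →+* Localization M := IsLocalization.lift hj
  let ψ : R →+* FractionRing (R ⧸ P) := (algebraMap (R ⧸ P) _).comp (Ideal.Quotient.mk P)
  have hcomp : φ.comp (algebraMap R B) = i.comp ψ := by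
    ext r
    simp [i, ψ, j]
  have htop : denominatorSubalgebra B P = ⊤ := by
    rw [eq_top_iff, ← hT, Algebra.adjoin_le_iff]
    intro t ht
    obtain ⟨z, hz⟩ := H _ _ i ψ φ hcomp t ht
    obtain ⟨r, ⟨s, hs⟩, rfl⟩ := IsLocalization.exists_mk'_eq (nonZeroDivisors (R ⧸ P)) z
    obtain ⟨r, rfl⟩ := Ideal.Quotient.mk_surjective r
    obtain ⟨s, rfl⟩ := Ideal.Quotient.mk_surjective s
    have hsP : s ∉ P := fun h => nonZeroDivisors.ne_zero hs (Ideal.Quotient.eq_zero_iff_mem.mpr h)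
    have h1 : φ (algebraMap R B r) = φ (algebraMap R B s * t) := by
      rw [map_mul, ← hz]
      have hmul := congrArg i (IsLocalization.mk'_spec' (FractionRing (R ⧸ P))
        (Ideal.Quotient.mk P r) ⟨_, hs⟩)
      rw [map_mul] at hmul
      have e := fun r => RingHom.congr_fun hcomp r
      simp only [RingHom.comp_apply, ψ] at e
      rw [e, e, hmul]
    -- The equality `t = r / s` holds in `B ⧸ J` after multiplication by some `s'` outside `P`. The
    -- error lies in the conductor, hence in the image of `R`.
    obtain ⟨⟨_, s', hs', rfl⟩, hc⟩ := (IsLocalization.eq_iff_exists M (Localization M)).mp h1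
    refine ⟨s' * s, fun h => (hPp.mem_or_mem h).elim hs' hsP, ?_⟩
    have hc' : q (algebraMap R B s' * algebraMap R B r) =
        q (algebraMap R B s' * (algebraMap R B s * t)) := by
      rw [map_mul, map_mul q]; exact hc
    have := mem_range_of_mem_conductorIdeal (Ideal.Quotient.eq.mp hc'.symm)
    rw [← map_mul] at this
    rw [map_mul, mul_assoc]
    simpa using add_mem this ⟨s' * r, rfl⟩
  -- A common denominator lies in the conductor, hence in `P`: a contradiction.
  obtain ⟨s, hs, h⟩ := exists_common_denominator P htop
  exact hs (hP.1.2 h)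

/-! ### Descent of coefficients to a seminormal domain. -/

theorem IsReduced.polynomial {C : Type*} [CommRing C] [IsReduced C] : IsReduced C[X] where
  eq_zero f hf := by
    ext n
    exact (Polynomial.isNilpotent_iff.mp hf n).eq_zero

/-- Units of a polynomial ring over a reduced ring are constant. -/
theorem Polynomial.mem_lifts_of_mul_eq_one {k C : Type*} [CommRing k] [CommRing C] [IsReduced C]
    (i : k →+* C) {u v : C[X]} (huv : u * v = 1) (hu : u.coeff 0 ∈ i.range) : u ∈ lifts i := by
  rw [lifts_iff_coeff_lifts]
  intro n
  rcases eq_or_ne n 0 with rfl | hn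
  · exact hu
  · rw [((coeff_isUnit_isNilpotent_of_isUnit (IsUnit.of_mul_eq_one v huv)).2 n hn).eq_zero]
    exact ⟨0, map_zero i⟩

theorem IsSeminormalDomain.mem_range_of_pow {R K : Type*} [CommRing R] [CommRing K] [IsDomain K]
    [Algebra R K] [FaithfulSMul R K] (hR : IsSeminormalDomain R) {x : K}
    (h2 : x ^ 2 ∈ (algebraMap R K).range) (h3 : x ^ 3 ∈ (algebraMap R K).range) :
    x ∈ (algebraMap R K).range := by
  obtain ⟨r, hr⟩ := h2
  obtain ⟨s, hs⟩ := h3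
  obtain ⟨c, hcs, hcr⟩ := hR.exists_root s r <| FaithfulSMul.algebraMap_injective R K <| by
    rw [map_pow, map_pow, hr, hs]; ring
  refine ⟨c, ?_⟩
  rw [← hcr, map_pow] at hr
  rw [← hcs, map_pow] at hs
  rcases eq_or_ne x 0 with rfl | hx
  · simpa using hr
  · apply mul_right_cancel₀ (pow_ne_zero 2 hx)
    rw [← hr, ← pow_succ', hs, hr, pow_succ']

/-- If `R` is a seminormal domain, polynomials with integral coefficients over an extension domain
`K` have coefficients in `R` as soon as they become rational in all reduced algebras over fields. -/
theorem IsSeminormalDomain.mem_lifts_of_isIntegral {R K : Type u} [CommRing R] [CommRing K] [IsDomain K]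
    [Algebra R K] [FaithfulSMul R K] (hR : IsSeminormalDomain R) {ι : Type*} [Finite ι]
    (f : ι → K[X]) (hf : ∀ j n, IsIntegral R ((f j).coeff n))
    (H : ∀ (B : Subalgebra R K) (F : ι → B[X]), (∀ j, (F j).map (algebraMap B K) = f j) →
      ∀ (k C : Type u) [Field k] [CommRing C] [IsReduced C] (i : k →+* C)
      (ψ : R →+* k) (φ : B →+* C), φ.comp (algebraMap R B) = i.comp ψ →
      ∀ j, (F j).map φ ∈ lifts i) (j : ι) :
    f j ∈ lifts (algebraMap R K) := by
  let T : Set K := ⋃ j, ((f j).coeffs : Set K)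
  have hTfin : T.Finite := Set.finite_iUnion fun j => Finset.finite_toSet _
  have hTint : ∀ x ∈ T, IsIntegral R x := by
    intro x hx
    obtain ⟨j, hx⟩ := Set.mem_iUnion.mp hx
    obtain ⟨n, -, rfl⟩ := Polynomial.mem_coeffs_iff.mp hx
    exact hf j n
  let B := Algebra.adjoin R T
  have : Module.Finite R B := Module.Finite.of_fg (fg_adjoin_of_finite hTfin hTint)
  have hlift : ∀ j, ∃ F : B[X], F.map (algebraMap B K) = f j := by
    intro j
    rw [← mem_lifts, lifts_iff_coeffs_subset_range]
    intro x hx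
    exact ⟨⟨x, Algebra.subset_adjoin (Set.mem_iUnion.mpr ⟨j, hx⟩)⟩, rfl⟩
  choose F hF using hlift
  have : FaithfulSMul R B := (faithfulSMul_iff_algebraMap_injective R B).mpr <| by
    apply Function.Injective.of_comp (f := algebraMap B K)
    rw [← RingHom.coe_comp, ← IsScalarTower.algebraMap_eq]
    exact FaithfulSMul.algebraMap_injective R K
  have hsurj : Function.Surjective (algebraMap R B) := by
    refine algebraMap_surjective_of_generators (fun x h2 h3 => hR.mem_range_of_pow h2 h3)
      (Subtype.val ⁻¹' T) Algebra.adjoin_adjoin_coe_preimage ?_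
    intro k C _ _ _ i ψ φ hφ t ht
    obtain ⟨j, hx⟩ := Set.mem_iUnion.mp ht
    obtain ⟨n, -, hn⟩ := Polynomial.mem_coeffs_iff.mp hx
    have ht' : t = (F j).coeff n := by
      apply Subtype.val_injective
      rw [hn, ← hF j, coeff_map]
      rfl
    have := (lifts_iff_coeff_lifts _).mp (H B F hF k C i ψ φ hφ j) n
    rwa [coeff_map, ← ht'] at this
  rw [← hF j, lifts_iff_coeff_lifts]
  intro n
  obtain ⟨r, hr⟩ := hsurj ((F j).coeff n)
  exact ⟨r, by rw [coeff_map, ← hr, ← IsScalarTower.algebraMap_apply]⟩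

/-! ### Seminormality of polynomial rings. -/

theorem IsIntegrallyClosed.exists_root {A : Type*} [CommRing A] [IsDomain A] [IsIntegrallyClosed A]
    {a b : A} (h : a ^ 2 = b ^ 3) : ∃ c, c ^ 3 = a ∧ c ^ 2 = b := by
  rcases eq_or_ne b 0 with rfl | hb
  · have ha : a = 0 := by simpa using h
    refine ⟨0, ?_, ?_⟩ <;> simp [ha]
  · obtain ⟨c, rfl⟩ := (IsIntegrallyClosed.pow_dvd_pow_iff two_ne_zero).mp
      (show b ^ 2 ∣ a ^ 2 from ⟨b, by rw [h]; ring⟩)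
    have hc : c ^ 2 = b := mul_left_cancel₀ (pow_ne_zero 2 hb) (by rw [← mul_pow, h]; ring)
    exact ⟨c, by rw [pow_succ, hc], hc⟩

theorem eq_of_pow_two_eq_of_pow_three_eq {C : Type*} [CommRing C] [IsReduced C] {x y : C}
    (h2 : x ^ 2 = y ^ 2) (h3 : x ^ 3 = y ^ 3) : x = y := by
  rw [← sub_eq_zero]
  apply eq_zero_of_pow_eq_zero (n := 3)
  linear_combination 4 * h3 - 3 * (x + y) * h2

attribute [local instance] Polynomial.algebra in
/-- The polynomial ring over a seminormal domain is seminormal. -/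
theorem IsSeminormalDomain.polynomial {R : Type u} [CommRing R] (hR : IsSeminormalDomain R) :
    IsSeminormalDomain R[X] := by
  have := hR.isDomain
  refine ⟨inferInstance, fun a b hab => ?_⟩
  let K := FractionRing R
  have hinj : Function.Injective (Polynomial.map (algebraMap R K)) :=
    Polynomial.map_injective _ (FaithfulSMul.algebraMap_injective R K)
  obtain ⟨c, hca, hcb⟩ := IsIntegrallyClosed.exists_root
    (a := a.map (algebraMap R K)) (b := b.map (algebraMap R K))
    (by rw [← Polynomial.map_pow, hab, Polynomial.map_pow])
  have hint : ∀ n, IsIntegral R (c.coeff n) := by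
    apply IsIntegral.coeff
    apply IsIntegral.of_pow (n := 2) two_pos
    rw [hcb]
    exact isIntegral_algebraMap
  have hc := hR.mem_lifts_of_isIntegral (fun _ : Unit => c) (fun _ => hint) (by
    intro B F hF k C _ _ _ i ψ φ hφ _
    have hB : Function.Injective (Polynomial.map (algebraMap B K)) :=
      Polynomial.map_injective _ Subtype.val_injective
    have hmap : ∀ r : R[X], (r.map (algebraMap R B)).map (algebraMap B K) =
        r.map (algebraMap R K) := fun r => by
      rw [Polynomial.map_map, ← IsScalarTower.algebraMap_eq]
    have hmap' : ∀ r : R[X], (r.map (algebraMap R B)).map φ = (r.map ψ).map i := fun r => by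
      rw [Polynomial.map_map, Polynomial.map_map, hφ]
    have h3 : F () ^ 3 = a.map (algebraMap R B) := hB <| by
      rw [Polynomial.map_pow, hF, hca, hmap]
    have h2 : F () ^ 2 = b.map (algebraMap R B) := hB <| by
      rw [Polynomial.map_pow, hF, hcb, hmap]
    -- Over the field `k` a root exists in `k[X]`; in the reduced ring `C[X]` its square and cube
    -- determine it, so it is the image of `F ()`.
    obtain ⟨e, hea, heb⟩ := IsIntegrallyClosed.exists_root (a := a.map ψ) (b := b.map ψ)
      (by rw [← Polynomial.map_pow, hab, Polynomial.map_pow])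
    have := IsReduced.polynomial (C := C)
    rw [mem_lifts]
    refine ⟨e, eq_of_pow_two_eq_of_pow_three_eq ?_ ?_⟩
    · rw [← Polynomial.map_pow, ← Polynomial.map_pow, heb, h2, hmap']
    · rw [← Polynomial.map_pow, ← Polynomial.map_pow, hea, h3, hmap']) ()
  obtain ⟨d, hd⟩ := (mem_lifts _).mp hc
  refine ⟨d, hinj ?_, hinj ?_⟩
  · rw [Polynomial.map_pow, hd, hca]
  · rw [Polynomial.map_pow, hd, hcb]

/-! ### Integrality of coefficients of factors. -/

theorem Polynomial.reverse_monic {A : Type*} [CommRing A] [Nontrivial A] {p : A[X]}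
    (hp : p.coeff 0 = 1) : p.reverse.Monic := by
  have h0 : p.coeff 0 ≠ 0 := by simp [hp]
  rw [Monic, reverse_leadingCoeff, trailingCoeff, natTrailingDegree_eq_zero.mpr (.inr h0), hp]

/-- Constant term `1` makes the reversed polynomials monic, and monic factors of a monic polynomial
over `R` have integral coefficients. -/
theorem Polynomial.isIntegral_coeff_of_mul_eq_map {R K : Type*} [CommRing R] [CommRing K]
    [IsDomain K] [Algebra R K] [FaithfulSMul R K] {s t : K[X]} {w : R[X]}
    (hs : s.coeff 0 = 1) (ht : t.coeff 0 = 1) (h : s * t = w.map (algebraMap R K)) (n : ℕ) :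
    IsIntegral R (s.coeff n) := by
  have hinj := FaithfulSMul.algebraMap_injective R K
  have : Nontrivial R := (algebraMap R K).domain_nontrivial
  have hw : w.coeff 0 = 1 := hinj <| by
    rw [← coeff_map, ← h, mul_coeff_zero, hs, ht, mul_one, map_one]
  have hrev : w.reverse.map (algebraMap R K) = s.reverse * t.reverse := by
    rw [← reverse_mul_of_domain, h, reverse, reverse, reflect_map, natDegree_map_eq_of_injective hinj]
  rcases le_or_gt n s.natDegree with hn | hn
  · have := isIntegral_coeff_of_dvd w.reverse s.reverse (reverse_monic hw)
      (reverse_monic hs) ⟨_, hrev⟩ (revAt s.natDegree n)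
    rwa [coeff_reverse, revAt_invol] at this
  · rw [coeff_eq_zero_of_natDegree_lt hn]
    exact isIntegral_zero

/-- Division by `t` as for power series: each coefficient of `p` comes from the earlier ones. -/
theorem Polynomial.isIntegral_coeff_of_mul {R K : Type*} [CommRing R] [CommRing K] [Algebra R K]
    {p t : K[X]} (ht0 : t.coeff 0 = 1) (ht : ∀ n, IsIntegral R (t.coeff n))
    (h : ∀ n, IsIntegral R ((p * t).coeff n)) (n : ℕ) : IsIntegral R (p.coeff n) := by
  induction n using Nat.strong_induction_on with
  | _ n ih =>
    have := h n
    rw [coeff_mul, Finset.Nat.sum_antidiagonal_eq_sum_range_succ_mk, Finset.sum_range_succ,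
      Nat.sub_self, ht0, mul_one] at this
    have hsum : IsIntegral R (∑ i ∈ Finset.range n, p.coeff i * t.coeff (n - i)) :=
      IsIntegral.sum _ fun i hi => (ih i (Finset.mem_range.mp hi)).mul (ht _)
    simpa using this.sub hsum

/-! ### Idempotent matrices as column times row. -/

/-- The matrix `!![a, b; c, d]` is the product of the column `(g, h)` and the row `(p, q)`, and
has trace `1`. -/
structure IsRankOneFactorization {A : Type*} [CommRing A] (a b c d g h p q : A) : Prop where
  gp : g * p = a
  gq : g * q = b
  hp : h * p = c
  hq : h * q = d
  trace : a + d = 1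

namespace IsRankOneFactorization

variable {A : Type*} [CommRing A] {a b c d g h p q : A}

theorem one (F : IsRankOneFactorization a b c d g h p q) : g * p + h * q = 1 := by
  rw [F.gp, F.hq, F.trace]

theorem map {A' : Type*} [CommRing A'] (F : IsRankOneFactorization a b c d g h p q)
    (φ : A →+* A') :
    IsRankOneFactorization (φ a) (φ b) (φ c) (φ d) (φ g) (φ h) (φ p) (φ q) where
  gp := by rw [← map_mul, F.gp]
  gq := by rw [← map_mul, F.gq]
  hp := by rw [← map_mul, F.hp]
  hq := by rw [← map_mul, F.hq]
  trace := by rw [← map_add, F.trace, map_one]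

theorem scale (F : IsRankOneFactorization a b c d g h p q) {u v : A} (huv : u * v = 1) :
    IsRankOneFactorization a b c d (v * g) (v * h) (u * p) (u * q) where
  gp := by linear_combination g * p * huv + F.gp
  gq := by linear_combination g * q * huv + F.gq
  hp := by linear_combination h * p * huv + F.hp
  hq := by linear_combination h * q * huv + F.hq
  trace := F.trace

/-- Two factorizations of the same matrix differ by a unit. -/
theorem compare {g' h' p' q' : A} (F : IsRankOneFactorization a b c d g h p q)
    (F' : IsRankOneFactorization a b c d g' h' p' q') :
    (p * g' + q * h') * (p' * g + q' * h) = 1 ∧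
    p = (p * g' + q * h') * p' ∧ q = (p * g' + q * h') * q' ∧
    g = (p' * g + q' * h) * g' ∧ h = (p' * g + q' * h) * h' := by
  have o := F.one
  obtain ⟨h1, h2, h3, h4, -⟩ := F
  obtain ⟨e1, e2, e3, e4, -⟩ := F'
  have hp : p = (p * g' + q * h') * p' := by
    linear_combination -p * o - p * (e1 - h1) - q * (e3 - h3)
  have hq : q = (p * g' + q * h') * q' := by
    linear_combination -q * o - p * (e2 - h2) - q * (e4 - h4)
  refine ⟨?_, hp, hq, ?_, ?_⟩
  · linear_combination o - g * hp - h * hq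
  · linear_combination -g * o - g * (e1 - h1) - h * (e2 - h2)
  · linear_combination -h * o - g * (e3 - h3) - h * (e4 - h4)

theorem isPrincipal (F : IsRankOneFactorization a b c d g h p q) :
    (Ideal.span {a, b}).IsPrincipal := by
  refine ⟨g, le_antisymm ?_ ?_⟩
  · rw [Ideal.span_le]
    rintro x (rfl | rfl)
    · exact Ideal.mem_span_singleton.mpr ⟨p, F.gp.symm⟩
    · exact Ideal.mem_span_singleton.mpr ⟨q, F.gq.symm⟩
  · change Ideal.span {g} ≤ _
    rw [Ideal.span_singleton_le_iff_mem, Ideal.mem_span_pair]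
    exact ⟨g, h, by linear_combination g * F.one - g * F.gp - h * F.gq⟩

/-- A generator `g` of `(a, b)` gives the row `(p, q) = (a / g, b / g)`, which is unimodular, and
this forces `h`. If `g = 0`, the matrix has first row zero and lower right entry `1`. -/
theorem exists_of_isPrincipal [IsDomain A] (hdet : a * (1 - a) = b * c)
    (hab : (Ideal.span {a, b}).IsPrincipal) :
    ∃ g h p q, IsRankOneFactorization a b c (1 - a) g h p q := by
  obtain ⟨g, hg⟩ := hab
  change _ = Ideal.span {g} at hg
  obtain ⟨p, hp⟩ := Ideal.mem_span_singleton.mp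
    (hg ▸ Ideal.subset_span (Set.mem_insert a {b}) : a ∈ Ideal.span {g})
  obtain ⟨q, hq⟩ := Ideal.mem_span_singleton.mp
    (hg ▸ Ideal.subset_span (Set.mem_insert_of_mem a rfl) : b ∈ Ideal.span {g})
  obtain ⟨u, v, huv⟩ := Ideal.mem_span_pair.mp (hg ▸ Ideal.mem_span_singleton_self g)
  rcases eq_or_ne g 0 with rfl | hg0
  · rw [zero_mul] at hp hq
    exact ⟨0, 1, c, 1, by simp [hp], by simp [hq], by simp, by simp [hp], by ring⟩
  · have h1 : u * p + v * q = 1 := mul_left_cancel₀ hg0 <| by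
      linear_combination huv - u * hp - v * hq
    have h2 : p * (1 - a) = q * c := mul_left_cancel₀ hg0 <| by
      linear_combination hdet - (1 - a) * hp + c * hq
    refine ⟨g, u * c + v * (1 - a), p, q, hp.symm, hq.symm, ?_, ?_, by ring⟩
    · linear_combination c * h1 + v * h2
    · linear_combination (1 - a) * h1 - u * h2

/-- If the matrix and the constant terms of the factors are defined over `R`, then all
coefficients of the factors are integral over `R`. -/
theorem isIntegral_coeff {R K : Type*} [CommRing R] [CommRing K] [IsDomain K] [Algebra R K]
    [FaithfulSMul R K] {a b c d : R[X]} {g h p q : K[X]}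
    (F : IsRankOneFactorization (a.map (algebraMap R K)) (b.map (algebraMap R K))
      (c.map (algebraMap R K)) (d.map (algebraMap R K)) g h p q)
    (hg : g.coeff 0 ∈ (algebraMap R K).range) (hh : h.coeff 0 ∈ (algebraMap R K).range)
    (hp : p.coeff 0 ∈ (algebraMap R K).range) (hq : q.coeff 0 ∈ (algebraMap R K).range) (n : ℕ) :
    IsIntegral R (g.coeff n) ∧ IsIntegral R (h.coeff n) ∧ IsIntegral R (p.coeff n) ∧
      IsIntegral R (q.coeff n) := by
  obtain ⟨g0, hg⟩ := hg
  obtain ⟨h0, hh⟩ := hh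
  obtain ⟨p0, hp⟩ := hp
  obtain ⟨q0, hq⟩ := hq
  let ι := algebraMap R K
  have hone : ι g0 * ι p0 + ι h0 * ι q0 = 1 := by
    have := congrArg (fun f => f.coeff 0) F.one
    simpa [mul_coeff_zero, ← hg, ← hh, ← hp, ← hq] using this
  -- The product `s * t` combines the matrix entries, so it is defined over `R`; both factors have
  -- constant term `1`. Likewise `g * s`, `h * s`, `p * t`, `q * t` are over `R`, and dividing by
  -- `s` or `t` gives integrality.
  let s := C (ι g0) * p + C (ι h0) * q
  let t := C (ι p0) * g + C (ι q0) * h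
  have hs0 : s.coeff 0 = 1 := by
    simp only [s, coeff_add, coeff_C_mul, ← hp, ← hq]; exact hone
  have ht0 : t.coeff 0 = 1 := by
    simp only [t, coeff_add, coeff_C_mul, ← hg, ← hh]; linear_combination hone
  have hst : s * t = (C (g0 * p0) * a + C (g0 * q0) * c + C (h0 * p0) * b +
      C (h0 * q0) * d).map ι := by
    simp only [Polynomial.map_add, Polynomial.map_mul, map_C, map_mul, s, t, ι, ← F.gp, ← F.gq,
      ← F.hp, ← F.hq]
    ring
  have hs := isIntegral_coeff_of_mul_eq_map hs0 ht0 hst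
  have ht := isIntegral_coeff_of_mul_eq_map ht0 hs0 ((mul_comm t s).trans hst)
  have key : ∀ {x y : K[X]} (w : R[X]), y.coeff 0 = 1 → (∀ n, IsIntegral R (y.coeff n)) →
      x * y = w.map ι → IsIntegral R (x.coeff n) := by
    intro x y w hy0 hy hxy
    refine isIntegral_coeff_of_mul hy0 hy (fun m => ?_) n
    rw [hxy, coeff_map]
    exact isIntegral_algebraMap
  refine ⟨key (C g0 * a + C h0 * b) hs0 hs ?_, key (C g0 * c + C h0 * d) hs0 hs ?_,
    key (C p0 * a + C q0 * c) ht0 ht ?_, key (C p0 * b + C q0 * d) ht0 ht ?_⟩ <;>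
  · simp only [Polynomial.map_add, Polynomial.map_mul, map_C, s, t, ι, ← F.gp, ← F.gq,
      ← F.hp, ← F.hq]
    ring

/-- Over a reduced extension `C` of a field `k`, a factorization of a matrix over `k[X]` whose
constant terms lie in `k` is defined over `k`. -/
theorem mem_lifts {k C : Type*} [Field k] [CommRing C] [IsReduced C] {i : k →+* C} {a b c : k[X]}
    {g h p q : C[X]}
    (F : IsRankOneFactorization (a.map i) (b.map i) (c.map i) ((1 - a).map i) g h p q)
    (hg : g.coeff 0 ∈ i.range) (hh : h.coeff 0 ∈ i.range)
    (hp : p.coeff 0 ∈ i.range) (hq : q.coeff 0 ∈ i.range) :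
    g ∈ lifts i ∧ h ∈ lifts i ∧ p ∈ lifts i ∧ q ∈ lifts i := by
  rcases subsingleton_or_nontrivial C with hC | hC
  · have : ∀ f : C[X], f ∈ lifts i := fun f => Subsingleton.elim 0 f ▸ zero_mem _
    exact ⟨this _, this _, this _, this _⟩
  have hdet : a * (1 - a) = b * c := Polynomial.map_injective i i.injective <| by
    rw [Polynomial.map_mul, Polynomial.map_mul, ← F.gp, ← F.gq, ← F.hp, ← F.hq]
    ring
  obtain ⟨g', h', p', q', F'⟩ := exists_of_isPrincipal hdet (IsPrincipalIdealRing.principal _)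
  -- The unit relating the given factorization to one over `k[X]` is constant, with value in `k`.
  obtain ⟨huv, ep, eq, eg, eh⟩ := F.compare (F'.map (mapRingHom i))
  simp only [coe_mapRingHom] at huv ep eq eg eh
  have h0 : ∀ f : k[X], (f.map i).coeff 0 ∈ i.range := fun f => ⟨_, (coeff_map i 0).symm⟩
  have hu := mem_lifts_of_mul_eq_one i huv (by
    rw [coeff_add, mul_coeff_zero, mul_coeff_zero]
    exact add_mem (mul_mem hp (h0 _)) (mul_mem hq (h0 _)))
  have hv := mem_lifts_of_mul_eq_one i ((mul_comm _ _).trans huv) (by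
    rw [coeff_add, mul_coeff_zero, mul_coeff_zero]
    exact add_mem (mul_mem (h0 _) hg) (mul_mem (h0 _) hh))
  have hl : ∀ f : k[X], f.map i ∈ lifts i := fun f => (Polynomial.mem_lifts _).mpr ⟨f, rfl⟩
  refine ⟨?_, ?_, ?_, ?_⟩
  · rw [eg]; exact mul_mem hv (hl _)
  · rw [eh]; exact mul_mem hv (hl _)
  · rw [ep]; exact mul_mem hu (hl _)
  · rw [eq]; exact mul_mem hu (hl _)

end IsRankOneFactorization

/-- Over a seminormal domain, a factorization over the fraction field of a matrix of polynomials
whose constant terms are defined over `R` is defined over `R`. -/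
theorem IsSeminormalDomain.exists_rankOneFactorization {R K : Type u} [CommRing R] [CommRing K]
    [IsDomain K] [Algebra R K] [FaithfulSMul R K] (hR : IsSeminormalDomain R) {a b c : R[X]}
    {g h p q : K[X]}
    (F : IsRankOneFactorization (a.map (algebraMap R K)) (b.map (algebraMap R K))
      (c.map (algebraMap R K)) ((1 - a).map (algebraMap R K)) g h p q)
    (hg : g.coeff 0 ∈ (algebraMap R K).range) (hh : h.coeff 0 ∈ (algebraMap R K).range)
    (hp : p.coeff 0 ∈ (algebraMap R K).range) (hq : q.coeff 0 ∈ (algebraMap R K).range) :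
    ∃ g h p q, IsRankOneFactorization a b c (1 - a) g h p q := by
  have hinj : Function.Injective (Polynomial.map (algebraMap R K)) :=
    Polynomial.map_injective _ (FaithfulSMul.algebraMap_injective R K)
  have hint := F.isIntegral_coeff hg hh hp hq
  have hlift := hR.mem_lifts_of_isIntegral ![g, h, p, q]
    (by
      intro j n
      obtain ⟨h1, h2, h3, h4⟩ := hint n
      fin_cases j
      exacts [h1, h2, h3, h4])
    (by
      intro B f hf k C _ _ _ i ψ φ hφ
      have hBinj : Function.Injective (Polynomial.map (algebraMap B K)) :=
        Polynomial.map_injective _ Subtype.val_injective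
      have hmap : ∀ r : R[X], (r.map (algebraMap R B)).map (algebraMap B K) =
          r.map (algebraMap R K) := fun r => by
        rw [Polynomial.map_map, ← IsScalarTower.algebraMap_eq]
      have hmap' : ∀ r : R[X], (r.map (algebraMap R B)).map φ = (r.map ψ).map i := fun r => by
        rw [Polynomial.map_map, Polynomial.map_map, hφ]
      have hconst : ∀ j, (f j).coeff 0 ∈ (algebraMap R B).range := by
        intro j
        have : ((![g, h, p, q] : Fin 4 → K[X]) j).coeff 0 ∈ (algebraMap R K).range := by
          fin_cases j
          exacts [hg, hh, hp, hq]
        obtain ⟨r, hr⟩ := this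
        refine ⟨r, Subtype.val_injective ?_⟩
        rw [← hf j, coeff_map] at hr
        exact hr
      have hconst' : ∀ j, ((f j).map φ).coeff 0 ∈ i.range := by
        intro j
        obtain ⟨r, hr⟩ := hconst j
        exact ⟨ψ r, by rw [coeff_map, ← hr, ← RingHom.comp_apply, ← RingHom.comp_apply, hφ]⟩
      have FB : IsRankOneFactorization (a.map (algebraMap R B)) (b.map (algebraMap R B))
          (c.map (algebraMap R B)) ((1 - a).map (algebraMap R B)) (f 0) (f 1) (f 2) (f 3) := by
        have e0 : (f 0).map (algebraMap B K) = g := hf 0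
        have e1 : (f 1).map (algebraMap B K) = h := hf 1
        have e2 : (f 2).map (algebraMap B K) = p := hf 2
        have e3 : (f 3).map (algebraMap B K) = q := hf 3
        constructor
        · apply hBinj; rw [Polynomial.map_mul, e0, e2, F.gp, hmap]
        · apply hBinj; rw [Polynomial.map_mul, e0, e3, F.gq, hmap]
        · apply hBinj; rw [Polynomial.map_mul, e1, e2, F.hp, hmap]
        · apply hBinj; rw [Polynomial.map_mul, e1, e3, F.hq, hmap]
        · rw [← Polynomial.map_add, add_sub_cancel, Polynomial.map_one]
      have FC := FB.map (mapRingHom φ)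
      simp only [coe_mapRingHom, hmap'] at FC
      rw [Polynomial.map_sub (f := ψ), Polynomial.map_one] at FC
      obtain ⟨h1, h2, h3, h4⟩ := FC.mem_lifts (hconst' 0) (hconst' 1) (hconst' 2) (hconst' 3)
      intro j
      fin_cases j
      exacts [h1, h2, h3, h4])
  obtain ⟨g', rfl⟩ := (Polynomial.mem_lifts g).mp (hlift 0)
  obtain ⟨h', rfl⟩ := (Polynomial.mem_lifts h).mp (hlift 1)
  obtain ⟨p', rfl⟩ := (Polynomial.mem_lifts p).mp (hlift 2)
  obtain ⟨q', rfl⟩ := (Polynomial.mem_lifts q).mp (hlift 3)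
  refine ⟨g', h', p', q', hinj ?_, hinj ?_, hinj ?_, hinj ?_, by ring⟩
  · rw [Polynomial.map_mul, F.gp]
  · rw [Polynomial.map_mul, F.gq]
  · rw [Polynomial.map_mul, F.hp]
  · rw [Polynomial.map_mul, F.hq]

/-! ### The PRINC property of polynomial rings. -/

theorem isPRINCDomain_of_dvd {R : Type*} [CommRing R] [IsDomain R]
    (h : ∀ a b c : R, a * (1 - a) = b * c → (Ideal.span {a, b}).IsPrincipal) :
    IsPRINCDomain R where
  isDomain := inferInstance
  isPrincipal a b hab := by
    rcases hab with ⟨c, hc⟩ | ⟨c, hc⟩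
    · exact h a b c hc
    · rw [Set.pair_comm]; exact h b a c hc

/-- The polynomial ring over a seminormal PRINC domain is a PRINC domain. -/
theorem IsPRINCDomain.polynomial {R : Type u} [CommRing R] (hprinc : IsPRINCDomain R)
    (hsemi : IsSeminormalDomain R) : IsPRINCDomain R[X] := by
  have := hprinc.isDomain
  refine isPRINCDomain_of_dvd fun a b c hdet => ?_
  let K := FractionRing R
  let ι := algebraMap R K
  have hdetK : a.map ι * (1 - a.map ι) = b.map ι * c.map ι := by
    simpa using congrArg (Polynomial.map ι) hdet
  obtain ⟨g, h, p, q, F⟩ := IsRankOneFactorization.exists_of_isPrincipal hdetK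
    (IsPrincipalIdealRing.principal _)
  have hdet0 : a.coeff 0 * (1 - a.coeff 0) = b.coeff 0 * c.coeff 0 := by
    simpa [mul_coeff_zero] using congrArg (fun f => f.coeff 0) hdet
  obtain ⟨g0, h0, p0, q0, F0⟩ := IsRankOneFactorization.exists_of_isPrincipal hdet0
    (hprinc.isPrincipal _ _ (.inl ⟨_, hdet0⟩))
  have FK := F.map constantCoeff
  have FK0 := F0.map ι
  simp only [constantCoeff_apply, coeff_map, coeff_sub, coeff_one_zero] at FK
  rw [map_sub, map_one] at FK0
  obtain ⟨huv, hp, hq, hg, hh⟩ := FK0.compare FK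
  -- Rescaling by the unit of `K` between the two factorizations at `X = 0` turns the constant terms
  -- into `g0`, `h0`, `p0`, `q0`.
  have F' := F.scale (u := C _) (v := C _) (by rw [← C_mul, huv, C_1])
  obtain ⟨_, _, _, _, F''⟩ := hsemi.exists_rankOneFactorization (K := K) (a := a) (b := b) (c := c)
    (by rw [Polynomial.map_sub, Polynomial.map_one]; exact F')
    ⟨g0, by rw [coeff_C_mul]; exact hg⟩ ⟨h0, by rw [coeff_C_mul]; exact hh⟩
    ⟨p0, by rw [coeff_C_mul]; exact hp⟩ ⟨q0, by rw [coeff_C_mul]; exact hq⟩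
  exact F''.isPrincipal

/-! ### The tower ring as a union of polynomial rings. -/

section Tower

variable (D₀ : Type*) [CommRing D₀]

theorem towerGen_eq_mul (n : ℕ+) :
    towerGen D₀ n = towerGen D₀ (n + 1) * (1 + towerGen D₀ (n + 1)) :=
  Ideal.Quotient.eq.mpr (Ideal.subset_span ⟨n, rfl⟩)

theorem towerGen_mem_adjoin {k n : ℕ+} (h : k ≤ n) :
    towerGen D₀ k ∈ Algebra.adjoin D₀ {towerGen D₀ n} := by
  induction n using PNat.recOn with
  | one =>
    rw [le_antisymm h one_le]
    exact Algebra.self_mem_adjoin_singleton _ _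
  | succ n ih =>
    rcases h.lt_or_eq with hlt | rfl
    · refine Algebra.adjoin_le ?_ (ih (PNat.lt_add_one_iff.mp hlt))
      rw [Set.singleton_subset_iff, towerGen_eq_mul D₀ n]
      have := Algebra.self_mem_adjoin_singleton D₀ (towerGen D₀ (n + 1))
      exact mul_mem this (add_mem (one_mem _) this)
    · exact Algebra.self_mem_adjoin_singleton _ _

theorem towerSubring_eq_adjoin_singleton (n : ℕ+) :
    towerSubring D₀ n = Algebra.adjoin D₀ {towerGen D₀ n} := by
  refine le_antisymm (Algebra.adjoin_le ?_) (Algebra.adjoin_mono ?_)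
  · rintro _ ⟨k, hk, rfl⟩
    exact towerGen_mem_adjoin D₀ hk
  · rw [Set.singleton_subset_iff]
    exact ⟨n, Set.self_mem_Iic, rfl⟩

theorem towerSubring_mono : Monotone (towerSubring D₀) := fun _ _ h =>
  Algebra.adjoin_mono (Set.image_mono (Set.Iic_subset_Iic.mpr h))

theorem towerGen_mem_towerSubring {k n : ℕ+} (h : k ≤ n) : towerGen D₀ k ∈ towerSubring D₀ n :=
  Algebra.subset_adjoin ⟨k, h, rfl⟩

variable {D₀}

theorem mem_towerSubring_iff {n : ℕ+} {z : TowerRing D₀} :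
    z ∈ towerSubring D₀ n ↔ ∃ p : D₀[X], aeval (towerGen D₀ n) p = z := by
  rw [towerSubring_eq_adjoin_singleton, Algebra.adjoin_singleton_eq_range_aeval]
  rfl

theorem exists_mem_towerSubring (z : TowerRing D₀) : ∃ n, z ∈ towerSubring D₀ n := by
  obtain ⟨p, rfl⟩ := Ideal.Quotient.mk_surjective z
  induction p using MvPolynomial.induction_on with
  | C r => exact ⟨1, (towerSubring D₀ 1).algebraMap_mem r⟩
  | add p q hp hq =>
    obtain ⟨m, hm⟩ := hp
    obtain ⟨n, hn⟩ := hq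
    rw [map_add]
    exact ⟨max m n, add_mem (towerSubring_mono D₀ (le_max_left m n) hm)
      (towerSubring_mono D₀ (le_max_right m n) hn)⟩
  | mul_X p i hp =>
    obtain ⟨m, hm⟩ := hp
    rw [map_mul]
    exact ⟨max m i, mul_mem (towerSubring_mono D₀ (le_max_left m i) hm)
      (towerGen_mem_towerSubring D₀ (le_max_right m i))⟩

/-- Finitely many elements of the tower ring are polynomials in a common generator. -/
theorem exists_forall_aeval_towerGen {ι : Type*} [Finite ι] (f : ι → TowerRing D₀) :
    ∃ n, ∃ F : ι → D₀[X], ∀ i, aeval (towerGen D₀ n) (F i) = f i := by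
  choose N hN using fun i => exists_mem_towerSubring (f i)
  obtain ⟨n, hn⟩ := Finite.exists_le N
  choose F hF using fun i => mem_towerSubring_iff.mp (towerSubring_mono D₀ (hn i) (hN i))
  exact ⟨n, F, hF⟩

theorem IsAlgClosed.exists_mul_one_add_eq {L : Type*} [Field L] [IsAlgClosed L] (x : L) :
    ∃ y, x = y * (1 + y) := by
  have hd : (X ^ 2 + X - C x : L[X]).degree = 2 := by compute_degree!
  obtain ⟨y, hy⟩ := IsAlgClosed.exists_root (X ^ 2 + X - C x : L[X]) (by rw [hd]; norm_num)
  refine ⟨y, ?_⟩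
  simp only [IsRoot, eval_sub, eval_add, eval_pow, eval_X, eval_C] at hy
  linear_combination -hy

/-- The tower is realized in an algebraically closed field by successively solving `x = y * (1 + y)`
from an indeterminate. If `t (n + 1)` were algebraic, so would be `t n`. The resulting map is
injective on each `D₀[x_n]`, hence on `R`. -/
theorem transcendental_towerGen_and_isDomain [IsDomain D₀] :
    (∀ n, Transcendental D₀ (towerGen D₀ n)) ∧ IsDomain (TowerRing D₀) := by
  let L := AlgebraicClosure (FractionRing D₀[X])
  have hLinj : Function.Injective (algebraMap D₀[X] L) := by
    rw [IsScalarTower.algebraMap_eq D₀[X] (FractionRing D₀[X]) L]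
    exact (algebraMap (FractionRing D₀[X]) L).injective.comp
      (IsFractionRing.injective D₀[X] (FractionRing D₀[X]))
  choose root hroot using IsAlgClosed.exists_mul_one_add_eq (L := L)
  let t : ℕ → L := fun n => root^[n] (algebraMap D₀[X] L X)
  have ht : ∀ n, t n = t (n + 1) * (1 + t (n + 1)) := fun n => by
    simp only [t, Function.iterate_succ_apply']
    exact hroot _
  have htrans : ∀ n, Transcendental D₀ (t n) := by
    intro n
    induction n with
    | zero =>
      exact (transcendental_algebraMap_iff hLinj).mpr (Polynomial.transcendental_X D₀)
    | succ n ih =>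
      intro h
      apply ih
      rw [ht]
      exact h.mul (isAlgebraic_one.add h)
  let φ : TowerRing D₀ →ₐ[D₀] L := Ideal.Quotient.liftₐ (towerIdeal D₀)
    (MvPolynomial.aeval fun n : ℕ+ => t n) <| by
      change towerIdeal D₀ ≤ RingHom.ker _
      rw [towerIdeal, Ideal.span_le]
      rintro _ ⟨i, rfl⟩
      simpa [sub_eq_zero] using ht i
  have hφ : ∀ n, φ (towerGen D₀ n) = t n := fun n =>
    MvPolynomial.aeval_X (fun n : ℕ+ => t n) n
  have hinj : Function.Injective φ := by
    rw [injective_iff_map_eq_zero]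
    intro z hz
    obtain ⟨n, hn⟩ := exists_mem_towerSubring z
    obtain ⟨p, rfl⟩ := mem_towerSubring_iff.mp hn
    rw [← aeval_algHom_apply, hφ] at hz
    rw [transcendental_iff.mp (htrans n) p hz, map_zero]
  refine ⟨fun n h => htrans n ?_, hinj.isDomain φ.toRingHom⟩
  rw [← hφ]
  exact h.algHom φ

theorem transcendental_towerGen [IsDomain D₀] (n : ℕ+) : Transcendental D₀ (towerGen D₀ n) :=
  transcendental_towerGen_and_isDomain.1 n

instance [IsDomain D₀] : IsDomain (TowerRing D₀) :=
  transcendental_towerGen_and_isDomain.2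

theorem aeval_towerGen_injective [IsDomain D₀] (n : ℕ+) :
    Function.Injective (aeval (R := D₀) (towerGen D₀ n)) :=
  transcendental_iff_injective.mp (transcendental_towerGen n)

theorem isSeminormalDomain_towerRing (hsemi : IsSeminormalDomain D₀) :
    IsSeminormalDomain (TowerRing D₀) := by
  have := hsemi.isDomain
  refine ⟨inferInstance, fun a b hab => ?_⟩
  obtain ⟨n, F, hF⟩ := exists_forall_aeval_towerGen ![a, b]
  obtain rfl : _ = a := hF 0
  obtain rfl : _ = b := hF 1
  rw [← map_pow, ← map_pow] at hab
  obtain ⟨c, hca, hcb⟩ := hsemi.polynomial.exists_root _ _ (aeval_towerGen_injective n hab)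
  exact ⟨aeval (towerGen D₀ n) c, by rw [← map_pow, hca], by rw [← map_pow, hcb]⟩

theorem isPRINCDomain_towerRing (hsemi : IsSeminormalDomain D₀) (hprinc : IsPRINCDomain D₀) :
    IsPRINCDomain (TowerRing D₀) := by
  have := hsemi.isDomain
  refine isPRINCDomain_of_dvd fun a b c hdet => ?_
  obtain ⟨n, F, hF⟩ := exists_forall_aeval_towerGen ![a, b, c]
  obtain rfl : _ = a := hF 0
  obtain rfl : _ = b := hF 1
  obtain rfl : _ = c := hF 2
  have hdet' : F 0 * (1 - F 0) = F 1 * F 2 := aeval_towerGen_injective n <| by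
    simpa only [map_mul, map_sub, map_one] using hdet
  obtain ⟨d, hd⟩ := (hprinc.polynomial hsemi).isPrincipal _ _ (.inl ⟨_, hdet'⟩)
  refine ⟨aeval (towerGen D₀ n) d, ?_⟩
  have := congrArg (Ideal.map (aeval (R := D₀) (towerGen D₀ n))) hd
  rw [Ideal.submodule_span_eq, Ideal.map_span, Ideal.map_span, Set.image_pair,
    Set.image_singleton] at this
  exact this

/-- A unit and its inverse lie in one polynomial ring over `D₀`, so the unit is a constant, which is
algebraic. -/
theorem not_isUnit_of_transcendental_towerRing [IsDomain D₀] {y : TowerRing D₀}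
    (hy : Transcendental D₀ y) : ¬ IsUnit y := by
  intro hu
  obtain ⟨z, hz⟩ := hu.exists_right_inv
  obtain ⟨n, F, hF⟩ := exists_forall_aeval_towerGen ![y, z]
  obtain rfl : _ = y := hF 0
  obtain rfl : _ = z := hF 1
  have h1 : F 0 * F 1 = 1 := aeval_towerGen_injective n <| by rw [map_mul, map_one, hz]
  obtain ⟨r, -, hr⟩ := Polynomial.isUnit_iff.mp (IsUnit.of_mul_eq_one _ h1)
  apply hy
  rw [← hr, aeval_C]
  exact isAlgebraic_algebraMap r

theorem not_isUnit_towerGen [IsDomain D₀] (n : ℕ+) : ¬ IsUnit (towerGen D₀ n) :=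
  not_isUnit_of_transcendental_towerRing (transcendental_towerGen n)

theorem not_isUnit_one_add_towerGen [IsDomain D₀] (n : ℕ+) : ¬ IsUnit (1 + towerGen D₀ n) := by
  refine not_isUnit_of_transcendental_towerRing fun h => transcendental_towerGen (D₀ := D₀) n ?_
  simpa using h.sub isAlgebraic_one

/-! ### Comaximal factorizations of `x₁`. -/

variable (D₀)

theorem towerGen_dvd {k n : ℕ+} (h : k ≤ n) : towerGen D₀ n ∣ towerGen D₀ k := by
  induction n using PNat.recOn with
  | one => rw [le_antisymm h one_le]
  | succ n ih =>
    rcases h.lt_or_eq with hlt | rfl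
    · exact Dvd.dvd.trans ⟨_, towerGen_eq_mul D₀ n⟩ (ih (PNat.lt_add_one_iff.mp hlt))
    · rfl

theorem isCoprime_towerGen_one_add {k n : ℕ+} (h : k ≤ n) :
    IsCoprime (towerGen D₀ n) (1 + towerGen D₀ k) :=
  IsCoprime.of_isCoprime_of_dvd_left ⟨-1, 1, by ring⟩ (towerGen_dvd D₀ h)

theorem isCoprime_one_add_towerGen {k n : ℕ+} (h : k < n) :
    IsCoprime (1 + towerGen D₀ n) (1 + towerGen D₀ k) := by
  obtain ⟨m, rfl⟩ := PNat.exists_eq_succ_of_ne_one (one_lt_of_gt h).ne'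
  exact IsCoprime.of_isCoprime_of_dvd_left
    (isCoprime_towerGen_one_add D₀ (PNat.lt_add_one_iff.mp h))
    ⟨_, (towerGen_eq_mul D₀ m).trans (mul_comm _ _)⟩

/-- As `n.succPNat` is `n + 1`, this reads `x_1 = x_{n+1}(1 + x_2)⋯(1 + x_{n+1})`. -/
theorem towerGen_one_eq_mul_prod (n : ℕ) :
    towerGen D₀ 1 = towerGen D₀ n.succPNat *
      ∏ k ∈ Finset.range n, (1 + towerGen D₀ (k + 1).succPNat) := by
  induction n with
  | zero => simp; rfl
  | succ n ih =>
    rw [ih, Finset.prod_range_succ, towerGen_eq_mul]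
    change towerGen D₀ (n + 1).succPNat * (1 + towerGen D₀ (n + 1).succPNat) * _ = _
    ring

theorem exists_isComaximalFactorization_towerGen_one [IsDomain D₀] {m : ℕ} (hm : 1 ≤ m) :
    ∃ f : Fin m → TowerRing D₀, IsComaximalFactorization (towerGen D₀ 1) f := by
  obtain ⟨n, rfl⟩ := Nat.exists_eq_add_of_le' hm
  have hcop : ∀ i : Fin n,
      IsCoprime (towerGen D₀ n.succPNat) (1 + towerGen D₀ ((i : ℕ) + 1).succPNat) := fun i =>
    isCoprime_towerGen_one_add D₀ (Nat.succPNat_le_succPNat.mpr i.isLt)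
  refine ⟨Fin.cons (towerGen D₀ n.succPNat)
    fun i : Fin n => 1 + towerGen D₀ ((i : ℕ) + 1).succPNat, ?_, ?_, ?_⟩
  · intro i
    cases i using Fin.cases with
    | zero => exact not_isUnit_towerGen _
    | succ i => exact not_isUnit_one_add_towerGen _
  · intro i j hij
    cases i using Fin.cases with
    | zero =>
      cases j using Fin.cases with
      | zero => exact absurd rfl hij
      | succ j => exact hcop j
    | succ i =>
      cases j using Fin.cases with
      | zero => exact (hcop i).symm
      | succ j =>
        simp only [Fin.cons_succ]
        rcases lt_trichotomy (i : ℕ) j with h | h | h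
        · exact (isCoprime_one_add_towerGen D₀
            (Nat.succPNat_lt_succPNat.mpr (Nat.succ_lt_succ h))).symm
        · exact absurd (congrArg Fin.succ (Fin.ext h)) hij
        · exact isCoprime_one_add_towerGen D₀
            (Nat.succPNat_lt_succPNat.mpr (Nat.succ_lt_succ h))
  · rw [Fin.prod_cons, towerGen_one_eq_mul_prod D₀ n, Finset.prod_range]

theorem not_isCFD_towerRing [IsDomain D₀] : ¬ IsCFD (TowerRing D₀) := by
  intro hcfd
  have hne : ∀ n, towerGen D₀ n ≠ 0 := fun n h =>
    transcendental_towerGen (D₀ := D₀) n (h ▸ isAlgebraic_zero)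
  obtain ⟨m, f, hirr, -, hprod⟩ := hcfd.exists_factorization _ (hne 1) (not_isUnit_towerGen 1)
  obtain ⟨n, F, hF⟩ := exists_forall_aeval_towerGen f
  obtain ⟨n, rfl⟩ : ∃ k : ℕ, n = k.succPNat := ⟨n.natPred, n.succPNat_natPred.symm⟩
  let y := towerGen D₀ n.succPNat
  let e := ∏ k ∈ Finset.range n, (1 + towerGen D₀ (k + 1).succPNat)
  have hy : towerGen D₀ 1 = y * e := towerGen_one_eq_mul_prod D₀ n
  have hle : ∀ k ∈ Finset.range n, (k + 1).succPNat ≤ n.succPNat := fun k hk =>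
    Nat.succPNat_le_succPNat.mpr (Finset.mem_range.mp hk)
  have he : e ∈ towerSubring D₀ n.succPNat := prod_mem fun k hk =>
    add_mem (one_mem _) (towerGen_mem_towerSubring D₀ (hle k hk))
  obtain ⟨E, hE⟩ := mem_towerSubring_iff.mp he
  have hFE : ∏ i, F i = X * E := aeval_towerGen_injective n.succPNat <| by
    rw [map_prod, map_mul, aeval_X, hE, ← hy, hprod]
    exact Finset.prod_congr rfl fun i _ => hF i
  -- With all factors in one `D₀[x_N]`, the prime `x_N` divides some `f i`.
  obtain ⟨i, -, G, hG⟩ := (Polynomial.prime_X.dvd_finsetProd_iff _).mp ⟨E, hFE⟩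
  let c := aeval (towerGen D₀ n.succPNat) G
  have hfi : f i = y * c := by rw [← hF i, hG, map_mul, aeval_X]
  have hc : c ∣ e := by
    obtain ⟨r, hr⟩ := Finset.dvd_prod_of_mem f (Finset.mem_univ i)
    refine ⟨r, mul_left_cancel₀ (hne n.succPNat) ?_⟩
    rw [← hprod, hfi] at hr
    rw [← mul_assoc, ← hr, hy]
  let z := towerGen D₀ (n.succPNat + 1)
  -- Replacing `y` by `z * (1 + z)` splits `f i`. The cofactor `c` divides a product of elements `1
  -- + x_k` with `k ≤ N`, each comaximal with `z = x_{N+1}`.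
  refine (hirr i).2.2 z ((1 + z) * c) (not_isUnit_towerGen _)
    (fun h => not_isUnit_one_add_towerGen _ (isUnit_of_mul_isUnit_left h)) ?_ ?_
  · refine (isCoprime_towerGen_one_add D₀ le_rfl).mul_right
      (IsCoprime.of_isCoprime_of_dvd_right (IsCoprime.prod_right fun k hk => ?_) hc)
    exact isCoprime_towerGen_one_add D₀ ((hle k hk).trans (PNat.lt_add_right _ _).le)
  · rw [hfi, ← mul_assoc]
    exact congrArg (· * c) (towerGen_eq_mul D₀ n.succPNat)

end Tower
theorem mainTheorem8 {D₀ : Type*} [CommRing D₀]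
    (hsemi : IsSeminormalDomain D₀) (hprinc : IsPRINCDomain D₀) :
    -- `R` is the increasing union of the polynomial rings `Rₙ = D₀[xₙ]`
    (∀ n : ℕ+, towerSubring D₀ n = Algebra.adjoin D₀ {towerGen D₀ n}) ∧
    (∀ n : ℕ+, Transcendental D₀ (towerGen D₀ n)) ∧
    Monotone (towerSubring D₀) ∧
    (⋃ n : ℕ+, (towerSubring D₀ n : Set (TowerRing D₀))) = Set.univ ∧
    -- `R` is a seminormal PRINC domain that is not a CFD
    IsSeminormalDomain (TowerRing D₀) ∧
    IsPRINCDomain (TowerRing D₀) ∧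
    ¬ IsCFD (TowerRing D₀) ∧
    -- `x₁` has comaximal factorizations of every length `m ≥ 1`
    (∀ m : ℕ, 1 ≤ m → ∃ f : Fin m → TowerRing D₀,
      IsComaximalFactorization (towerGen D₀ 1) f) := by
  have := hsemi.isDomain
  refine ⟨towerSubring_eq_adjoin_singleton D₀, transcendental_towerGen, towerSubring_mono D₀,
    Set.eq_univ_of_forall fun z => Set.mem_iUnion.mpr (exists_mem_towerSubring z),
    isSeminormalDomain_towerRing hsemi, isPRINCDomain_towerRing hsemi hprinc,
    not_isCFD_towerRing D₀, fun m hm => exists_isComaximalFactorization_towerGen_one D₀ hm⟩
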